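/- Let $N\ge 0$, let $\lambda_1,\dots,\lambda_N$ be distinct complex numbers with $\operatorname{Im}\lambda_n>0$, let $p_1,\dots,p_N\in\mathbb C\setminus\{0\}$, and put $$c_n=\frac1{p_n}\prod_{\ell=1}^N(\lambda_n-\overline{\lambda_\ell})\prod_{\ell\ne n}\frac1{\lambda_n-\lambda_\ell},\qquad n=1,\dots,N.$$ *Darboux solution.* For $(x,t)\in\mathbb R^2$ set $p_n(t)=p_ne^{-2it\lambda_n^2}$, $\psi_0=0$, $\Phi_0(z)=\operatorname{diag}(e^{-izx},e^{izx})$, and for $n=1,\dots,N$ let $\mathbf q_n=(q_{n1},q_{n2})^{\top}=\overline{\Phi_{n-1}(\overline{\lambda_n})}\,(1,p_n(t))^{\top}$, $$\psi_n=\psi_{n-1}+2i(\lambda_n-\overline{\lambda_n})\frac{\overline{q_{n1}}\,q_{n2}}{|\mathbf q_n|^2},\qquad \Phi_n(z)=\Big(I+\frac{\lambda_n-\overline{\lambda_n}}{z-\lambda_n}\,\frac{\overline{\mathbf q_n}\,\mathbf q_n^{\top}}{|\mathbf q_n|^2}\Big)\Phi_{n-1}(z).$$ Denote the resulting $\psi_N$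 by $\psi_N(x,t)$. *Inverse-scattering solution.* With $\theta(z;x,t)=zx+z^2t$, consider for each $(x,t)\in\mathbb R^2$ the reflectionless Riemann–Hilbert problem for the focusing NLS equation $i\psi_t=-\tfrac12\psi_{xx}-|\psi|^2\psi$: find a $2\times2$ matrix function $M(z)$, analytic in $\mathbb C$ except for (at most) simple poles at the points $\lambda_n,\overline{\lambda_n}$, such that for all $n$ $$\operatorname*{Res}_{\lambda_n}M=\lim_{z\to\lambda_n}M(z)\begin{pmatrix}0&0\\ c_ne^{2i\theta(\lambda_n;x,t)}&0\end{pmatrix},\qquad \operatorname*{Res}_{\overline{\lambda_n}}M=\lim_{z\to\overline{\lambda_n}}M(z)\begin{pmatrix}0&-\overline{c_n}e^{-2i\theta(\overline{\lambda_n};x,t)}\\0&0\end{pmatrix},$$ and $M(z)=I+O(z^{-1})$ as $z\to\infty$. Then for every $(x,t)\in\mathbb R^2$ this problem has exactly one solution $M$, and the two methods give the same NLS solution: $$\lim_{z\to\infty}2iz\,M_{12}(z)=\psi_N(x,t).$$ -/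

import Mathlib

open scoped ComplexConjugate
open Filter Topology

noncomputable section

namespace SolitonNLS

/-- Complex `2 × 2` matrices. -/
abbrev Mat2 : Type := Matrix (Fin 2) (Fin 2) ℂ

/-! ### The Darboux (dressing) construction at a fixed time -/

/-- The seed solution `Φ₀(x, z) = diag (exp (-i z x), exp (i z x))` of the Zakharov-Shabat system
with zero potential. -/
def seed (x : ℝ) (z : ℂ) : Mat2 :=
  !![Complex.exp (-Complex.I * z * x), 0;
     0, Complex.exp (Complex.I * z * x)]

/-- The vector `q = conj (Φ (x, conj μ)) (1, b)ᵀ`, where `Φ` is the current solution of the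
Zakharov-Shabat system (at a fixed `x`), `μ` the new eigenvalue and `b` its Darboux parameter. -/
def dressVec (Φ : ℂ → Mat2) (μ b : ℂ) : Fin 2 → ℂ :=
  ((Φ (conj μ)).map conj).mulVec ![1, b]

/-- The Hermitian norm squared `|q|² = |q₁|² + |q₂|²` (as a complex number). -/
def normSq2 (q : Fin 2 → ℂ) : ℂ := ((‖q 0‖ ^ 2 + ‖q 1‖ ^ 2 : ℝ) : ℂ)

/-- The dressing matrix
`χ(z)_{mℓ} = δ_{mℓ} + (μ - conj μ) / (z - μ) * conj (q_m) q_ℓ / |q|²`. -/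
def dressMatrix (μ : ℂ) (q : Fin 2 → ℂ) (z : ℂ) : Mat2 :=
  Matrix.of fun m l =>
    (if m = l then 1 else 0) + (μ - conj μ) / (z - μ) * (conj (q m) * q l / normSq2 q)

/-- The dressed solution `Φ_n(x, z)` of the Zakharov-Shabat system with eigenvalues `lam` and
Darboux parameters `b`. The solution with `n + 1` eigenvalues is obtained by adding the last
eigenvalue and parameter to the solution built from the first `n` of them. -/
def dressedPhi : (n : ℕ) → (Fin n → ℂ) → (Fin n → ℂ) → ℝ → ℂ → Mat2
  | 0, _, _, x, z => seed x z
  | n + 1, lam, b, x, z =>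
    let Φ : ℂ → Mat2 := dressedPhi n (fun k => lam k.castSucc) (fun k => b k.castSucc) x
    let q := dressVec Φ (lam (Fin.last n)) (b (Fin.last n))
    dressMatrix (lam (Fin.last n)) q z * Φ z

/-- The dressed potential: `ψ₀ = 0` and
`ψ_{n+1} = ψ_n + 2 i (μ - conj μ) conj (q₁) q₂ / |q|²` with `μ` the last eigenvalue. -/
def dressedPotential : (n : ℕ) → (Fin n → ℂ) → (Fin n → ℂ) → ℝ → ℂ
  | 0, _, _, _ => 0
  | n + 1, lam, b, x =>
    let Φ : ℂ → Mat2 := dressedPhi n (fun k => lam k.castSucc) (fun k => b k.castSucc) x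
    let μ := lam (Fin.last n)
    let q := dressVec Φ μ (b (Fin.last n))
    dressedPotential n (fun k => lam k.castSucc) (fun k => b k.castSucc) x
      + 2 * Complex.I * (μ - conj μ) * (conj (q 0) * q 1 / normSq2 q)

/-- The `N`-soliton solution `ψ_N(x, t)` of the Darboux method: the dressing construction applied to
the evolved data `{lam n, p n * exp (-2 i t (lam n)²)}`. -/
def darbouxSolution {N : ℕ} (lam p : Fin N → ℂ) (x t : ℝ) : ℂ :=
  dressedPotential N lam (fun n => p n * Complex.exp (-2 * Complex.I * t * lam n ^ 2)) x

/-! ### The reflectionless inverse-scattering (Riemann-Hilbert) construction -/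

/-- The phase `θ(z; x, t) = z x + z² t`. -/
def phase (z : ℂ) (x t : ℝ) : ℂ := z * x + z ^ 2 * t

/-- The set of points `lam n` and `conj (lam n)`. -/
def poleSet {N : ℕ} (lam : Fin N → ℂ) : Set ℂ :=
  {z | ∃ n, z = lam n ∨ z = conj (lam n)}

/-- `M` has at `w` (at most) a simple pole, whose residue `lim (z - w) M(z)` equals
`lim M(z) A`; both limits exist. For `M` analytic in a punctured neighbourhood of `w`, existence of
the first limit says exactly that the singularity is at most a simple pole. -/
def ResidueCondition (M : ℂ → Mat2) (w : ℂ) (A : Mat2) : Prop :=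
  ∃ R : Mat2,
    Tendsto (fun z => (z - w) • M z) (𝓝[≠] w) (𝓝 R) ∧
    Tendsto (fun z => M z * A) (𝓝[≠] w) (𝓝 R)

/-- `M` solves the Riemann-Hilbert problem of the focusing NLS equation with vanishing reflection
coefficient, eigenvalues `lam n` and normalization constants `c n`, at the point `(x, t)`.
The values of `M` at the poles themselves are irrelevant. -/
structure IsRHPSolution {N : ℕ} (lam c : Fin N → ℂ) (x t : ℝ) (M : ℂ → Mat2) : Prop where
  analytic : ∀ i j, DifferentiableOn ℂ (fun z => M z i j) (poleSet lam)ᶜ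
  residue_upper : ∀ n, ResidueCondition M (lam n)
    !![0, 0; c n * Complex.exp (2 * Complex.I * phase (lam n) x t), 0]
  residue_lower : ∀ n, ResidueCondition M (conj (lam n))
    !![0, -conj (c n) * Complex.exp (-2 * Complex.I * phase (conj (lam n)) x t); 0, 0]
  normalization : ∀ i j, (fun z => M z i j - (1 : Mat2) i j) =O[Bornology.cobounded ℂ]
    fun z => z⁻¹

/-- `ψ` is the reflectionless inverse-scattering solution with eigenvalues `lam n` and normalization
constants `c n`: for all `(x, t)`, the Riemann-Hilbert problem has a solution `M`, which is unique
(away from the poles), and `ψ(x, t) = lim_{z → ∞} 2 i z M₁₂(z)`. -/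
def IsISTSolution {N : ℕ} (lam c : Fin N → ℂ) (ψ : ℝ → ℝ → ℂ) : Prop :=
  ∀ x t : ℝ, ∃ M : ℂ → Mat2,
    IsRHPSolution lam c x t M ∧
    (∀ M' : ℂ → Mat2, IsRHPSolution lam c x t M' → Set.EqOn M' M (poleSet lam)ᶜ) ∧
    Tendsto (fun z => 2 * Complex.I * z * M z 0 1) (Bornology.cobounded ℂ) (𝓝 (ψ x t))

end SolitonNLS

end

namespace SolitonNLS

open Matrix

/-! ### The seed solution -/

/-! At fixed `(x, t)` the Riemann-Hilbert solution can be read off from the Darboux solution. Each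
dressing factor is `1 + a(z) P` with `P` a Hermitian rank-one projection. Hence `Φ_N(z)` has the
inverse Blaschke product as determinant, satisfies `Φ(z) Φ(conj z)ᴴ = 1`, and at `conj (lam k)`
kills `(1, conj b_k)` (`dressedPhi_conj_mulVec`). Let `D` be `Φ_N` with the seed exponentials
removed. Multiplying its second column by the Blaschke product moves that column's poles from `lam
k` to `conj (lam k)` (`rhpMatrix_eq`). The residue there is a multiple of the second column of `D`,
which the kernel vector makes proportional to the first: this is the residue condition, and the
product formula for `c n` is the resulting constant. The condition at `lam k` follows by symmetry.
The `1/z` coefficient of `D` is the sum of the terms `(μ - conj μ) P`, whose upper right entries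
also build the potential.

Uniqueness is Liouville's theorem for `M' * adj M`: both matrices have the same singular right
factor at each pole, and it cancels in the product. -/

theorem seed_mul_seed_neg (x : ℝ) (z : ℂ) : seed x z * seed x (-z) = 1 := by
  ext i j
  fin_cases i <;> fin_cases j <;> simp [seed, Matrix.mul_apply, ← Complex.exp_add]

theorem seed_neg_mul_seed (x : ℝ) (z : ℂ) : seed x (-z) * seed x z = 1 := by
  simpa using seed_mul_seed_neg x (-z)

theorem det_seed (x : ℝ) (z : ℂ) : (seed x z).det = 1 := by
  simp [seed, Matrix.det_fin_two, ← Complex.exp_add]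

theorem conjTranspose_seed_conj (x : ℝ) (z : ℂ) : (seed x (conj z))ᴴ = seed x (-z) := by
  ext i j
  fin_cases i <;> fin_cases j <;> simp [seed, ← Complex.exp_conj]

theorem differentiable_seed (x : ℝ) (i j : Fin 2) : Differentiable ℂ fun z => seed x z i j := by
  fin_cases i <;> fin_cases j <;> simp [seed] <;> fun_prop

/-! ### The dressing matrix -/

theorem normSq2_eq (q : Fin 2 → ℂ) : normSq2 q = conj (q 0) * q 0 + conj (q 1) * q 1 := by
  simp [normSq2, Complex.conj_mul']

theorem conj_normSq2 (q : Fin 2 → ℂ) : conj (normSq2 q) = normSq2 q := Complex.conj_ofReal _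

theorem normSq2_ne_zero {q : Fin 2 → ℂ} (hq : q ≠ 0) : normSq2 q ≠ 0 := by
  unfold normSq2
  rw [Complex.ofReal_ne_zero]
  contrapose! hq
  have h0 : ‖q 0‖ = 0 := by nlinarith [sq_nonneg ‖q 0‖, sq_nonneg ‖q 1‖]
  have h1 : ‖q 1‖ = 0 := by nlinarith [sq_nonneg ‖q 0‖, sq_nonneg ‖q 1‖]
  ext i
  fin_cases i
  · simpa using h0
  · simpa using h1

/-- The orthogonal projection onto the line spanned by `conj q`. -/
noncomputable def dressProj (q : Fin 2 → ℂ) : Mat2 :=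
  Matrix.of fun m l => conj (q m) * q l / normSq2 q

theorem dressMatrix_eq (μ : ℂ) (q : Fin 2 → ℂ) (z : ℂ) :
    dressMatrix μ q z = 1 + ((μ - conj μ) / (z - μ)) • dressProj q := by
  ext m l
  simp [dressMatrix, dressProj, Matrix.one_apply]

theorem dressProj_conjTranspose (q : Fin 2 → ℂ) : (dressProj q)ᴴ = dressProj q := by
  ext m l
  simp [dressProj, conj_normSq2, mul_comm]

theorem dressProj_mul_self {q : Fin 2 → ℂ} (hq : q ≠ 0) :
    dressProj q * dressProj q = dressProj q := by
  have h := normSq2_ne_zero hq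
  ext m l
  simp only [dressProj, Matrix.mul_apply, Fin.sum_univ_two, Matrix.of_apply]
  field_simp
  rw [normSq2_eq]
  ring

theorem dressProj_mulVec_conj {q : Fin 2 → ℂ} (hq : q ≠ 0) :
    dressProj q *ᵥ (fun i => conj (q i)) = fun i => conj (q i) := by
  have h := normSq2_ne_zero hq
  ext m
  simp only [dressProj, Matrix.mulVec, dotProduct, Fin.sum_univ_two, Matrix.of_apply]
  field_simp
  rw [normSq2_eq]
  ring

/-- For a rank-one projection `P`, `det (1 + a P) = 1 + a`. -/
theorem det_dressMatrix {μ : ℂ} {q : Fin 2 → ℂ} (hq : q ≠ 0) {z : ℂ} (hz : z ≠ μ) :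
    (dressMatrix μ q z).det = (z - conj μ) / (z - μ) := by
  have h := normSq2_ne_zero hq
  have hz' := sub_ne_zero.2 hz
  simp only [dressMatrix, Matrix.det_fin_two, Matrix.of_apply]
  simp
  field_simp
  rw [normSq2_eq]
  ring

/-- Since `P² = P = Pᴴ`, the product is `1 + (a + a' + a a') P`, and the coefficient vanishes for
the two values of `a` at `z` and `conj z`. -/
theorem dressMatrix_mul_conjTranspose {μ : ℂ} {q : Fin 2 → ℂ} (hq : q ≠ 0) {z : ℂ} (hz : z ≠ μ)
    (hz' : z ≠ conj μ) : dressMatrix μ q z * (dressMatrix μ q (conj z))ᴴ = 1 := by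
  have h1 := sub_ne_zero.2 hz
  have h2 := sub_ne_zero.2 hz'
  have h3 : star (((μ - conj μ) / (conj z - μ))) = (conj μ - μ) / (z - conj μ) := by simp
  rw [dressMatrix_eq, dressMatrix_eq, Matrix.conjTranspose_add, Matrix.conjTranspose_smul,
    dressProj_conjTranspose, Matrix.conjTranspose_one, h3]
  simp only [add_mul, mul_add, one_mul, mul_one, smul_mul_assoc, mul_smul_comm,
    dressProj_mul_self hq]
  rw [smul_add, smul_smul, add_assoc, ← add_smul, ← add_smul]
  convert add_zero (1 : Mat2)
  convert zero_smul ℂ (dressProj q)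
  field_simp
  ring

/-- At `conj μ` the coefficient of the projection is `-1`, so the factor is the complementary
projection `1 - P`. -/
theorem dressMatrix_conj_mulVec {μ : ℂ} {q : Fin 2 → ℂ} (hq : q ≠ 0) (hμ : μ ≠ conj μ) :
    dressMatrix μ q (conj μ) *ᵥ (fun i => conj (q i)) = 0 := by
  have h1 := sub_ne_zero.2 hμ.symm
  have h2 : (μ - conj μ) / (conj μ - μ) = -1 := by field_simp; ring
  rw [dressMatrix_eq, h2, Matrix.add_mulVec, Matrix.smul_mulVec, dressProj_mulVec_conj hq]
  simp

theorem differentiableOn_dressMatrix (μ : ℂ) (q : Fin 2 → ℂ) (i j : Fin 2) :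
    DifferentiableOn ℂ (fun z => dressMatrix μ q z i j) {μ}ᶜ := by
  intro z hz
  have h := sub_ne_zero.2 hz
  simp only [dressMatrix, Matrix.of_apply]
  apply DifferentiableAt.differentiableWithinAt
  fun_prop (disch := assumption)

theorem tendsto_cobounded_div_sub (a μ : ℂ) :
    Tendsto (fun z => z * (a / (z - μ))) (Bornology.cobounded ℂ) (𝓝 a) := by
  have h : Tendsto (fun z : ℂ => (1 - μ * z⁻¹)⁻¹ * a) (Bornology.cobounded ℂ) (𝓝 a) := by
    have h0 : Tendsto (fun z : ℂ => z⁻¹) (Bornology.cobounded ℂ) (𝓝 0) :=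
      tendsto_inv₀_cobounded
    have := (((h0.const_mul μ).const_sub 1).inv₀ (by simp)).mul_const a
    simpa using this
  refine h.congr' ?_
  filter_upwards [Bornology.eventually_ne_cobounded (0 : ℂ),
    Bornology.eventually_ne_cobounded μ] with z h0 hz'
  have h1 := sub_ne_zero.2 hz'
  have h2 : 1 - μ * z⁻¹ = (z - μ) / z := by field_simp
  rw [h2]
  field_simp

theorem tendsto_cobounded_dressMatrix (μ : ℂ) (q : Fin 2 → ℂ) :
    Tendsto (fun z => z • (dressMatrix μ q z - 1)) (Bornology.cobounded ℂ)
      (𝓝 ((μ - conj μ) • dressProj q)) := by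
  have := (tendsto_cobounded_div_sub (μ - conj μ) μ).smul_const (dressProj q)
  refine this.congr fun z => ?_
  rw [dressMatrix_eq, add_sub_cancel_left, smul_smul]

/-- If `z (F z - 1)` converges at infinity, then `F` tends to `1`. -/
theorem tendsto_one_of_tendsto_smul_sub {F : ℂ → Mat2} {K : Mat2}
    (h : Tendsto (fun z => z • (F z - 1)) (Bornology.cobounded ℂ) (𝓝 K)) :
    Tendsto F (Bornology.cobounded ℂ) (𝓝 1) := by
  have h0 : Tendsto (fun z : ℂ => z⁻¹) (Bornology.cobounded ℂ) (𝓝 0) := tendsto_inv₀_cobounded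
  have := (h0.smul h).add_const 1
  rw [zero_smul, zero_add] at this
  refine this.congr' ?_
  filter_upwards [Bornology.eventually_ne_cobounded (0 : ℂ)] with z hz
  rw [smul_smul, inv_mul_cancel₀ hz, one_smul, sub_add_cancel]

/-! ### The dressed solution -/

theorem ne_conj_of_im_pos {a b : ℂ} (ha : 0 < a.im) (hb : 0 < b.im) : a ≠ conj b := by
  intro h
  have := congrArg Complex.im h
  simp at this
  linarith

theorem dressVec_ne_zero {Φ : ℂ → Mat2} {μ : ℂ} (h : (Φ (conj μ)).det ≠ 0) (b : ℂ) :
    dressVec Φ μ b ≠ 0 := by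
  intro h0
  have hd : ((Φ (conj μ)).map conj).det ≠ 0 := by
    have : ((Φ (conj μ)).map conj).det = conj ((Φ (conj μ)).det) :=
      (RingHom.map_det (starRingEnd ℂ) (Φ (conj μ))).symm
    rw [this]
    simpa using h
  have := Matrix.eq_zero_of_mulVec_eq_zero hd h0
  simpa using congrFun this 0

theorem conj_dressVec (Φ : ℂ → Mat2) (μ b : ℂ) :
    (fun i => conj (dressVec Φ μ b i)) = Φ (conj μ) *ᵥ ![1, conj b] := by
  ext i
  simp [dressVec, Matrix.mulVec, dotProduct, Fin.sum_univ_two]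

theorem det_prod_ne_zero {n : ℕ} {lam : Fin n → ℂ} (hlam : ∀ k, 0 < (lam k).im) {μ : ℂ}
    (hμ : 0 < μ.im) (hne : ∀ k, lam k ≠ μ) :
    ∏ k, (conj μ - conj (lam k)) / (conj μ - lam k) ≠ 0 := by
  refine Finset.prod_ne_zero_iff.2 fun k _ => div_ne_zero ?_ ?_
  · exact sub_ne_zero.2 fun h => hne k ((starRingEnd ℂ).injective h).symm
  · exact sub_ne_zero.2 (ne_conj_of_im_pos (hlam k) hμ).symm

theorem det_dressedPhi {n : ℕ} {lam : Fin n → ℂ} (b : Fin n → ℂ) (x : ℝ)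
    (hlam : ∀ k, 0 < (lam k).im) (hinj : Function.Injective lam) {z : ℂ} (hz : ∀ k, z ≠ lam k) :
    (dressedPhi n lam b x z).det = ∏ k, (z - conj (lam k)) / (z - lam k) := by
  induction n generalizing z with
  | zero => simp [dressedPhi, det_seed]
  | succ n ih =>
    have ih' := @ih (fun k => lam k.castSucc) (fun k => b k.castSucc) (fun k => hlam _)
      (hinj.comp (Fin.castSucc_injective n))
    simp only [dressedPhi, Matrix.det_mul]
    rw [ih' fun k => hz _, det_dressMatrix (dressVec_ne_zero _ _) (hz _),
      Fin.prod_univ_castSucc, mul_comm]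
    -- What remains is `q ≠ 0`, which follows from the determinant formula for the previous stage at
    -- `conj μ`; this is where distinct eigenvalues are needed.
    rw [ih' fun k => (ne_conj_of_im_pos (hlam _) (hlam _)).symm]
    exact det_prod_ne_zero (fun k => hlam _) (hlam _)
      fun k => hinj.ne (Fin.castSucc_lt_last k).ne

/-- In the last step of the dressing construction the vector `q` does not vanish. -/
theorem dressVec_dressedPhi_ne_zero {n : ℕ} {lam : Fin (n + 1) → ℂ} (b : Fin (n + 1) → ℂ) (x : ℝ)
    (hlam : ∀ k, 0 < (lam k).im) (hinj : Function.Injective lam) :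
    dressVec (dressedPhi n (fun k => lam k.castSucc) (fun k => b k.castSucc) x)
      (lam (Fin.last n)) (b (Fin.last n)) ≠ 0 := by
  apply dressVec_ne_zero
  rw [det_dressedPhi _ _ (fun k => hlam _) (hinj.comp (Fin.castSucc_injective n))
    fun k => (ne_conj_of_im_pos (hlam _) (hlam _)).symm]
  exact det_prod_ne_zero (fun k => hlam _) (hlam _) fun k => hinj.ne (Fin.castSucc_lt_last k).ne

theorem dressedPhi_mul_conjTranspose {n : ℕ} {lam : Fin n → ℂ} (b : Fin n → ℂ) (x : ℝ)
    (hlam : ∀ k, 0 < (lam k).im) (hinj : Function.Injective lam) {z : ℂ} (hz : ∀ k, z ≠ lam k)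
    (hz' : ∀ k, z ≠ conj (lam k)) :
    dressedPhi n lam b x z * (dressedPhi n lam b x (conj z))ᴴ = 1 := by
  induction n with
  | zero => simp [dressedPhi, conjTranspose_seed_conj, seed_mul_seed_neg]
  | succ n ih =>
    simp only [dressedPhi, Matrix.conjTranspose_mul]
    rw [Matrix.mul_assoc, ← Matrix.mul_assoc (dressedPhi n _ _ _ _), ih, Matrix.one_mul,
      dressMatrix_mul_conjTranspose (dressVec_dressedPhi_ne_zero b x hlam hinj) (hz _) (hz' _)]
    exacts [fun k => hlam _, hinj.comp (Fin.castSucc_injective n), fun k => hz _, fun k => hz' _]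

/-- The newest factor kills the image of its own vector, because `q` was built from that image.
Later factors multiply on the left and so preserve kernels. -/
theorem dressedPhi_conj_mulVec {n : ℕ} {lam : Fin n → ℂ} (b : Fin n → ℂ) (x : ℝ)
    (hlam : ∀ k, 0 < (lam k).im) (hinj : Function.Injective lam) (k : Fin n) :
    dressedPhi n lam b x (conj (lam k)) *ᵥ ![1, conj (b k)] = 0 := by
  induction n with
  | zero => exact k.elim0
  | succ n ih =>
    simp only [dressedPhi]
    rw [← Matrix.mulVec_mulVec]
    refine Fin.lastCases ?_ (fun k => ?_) k
    · rw [← conj_dressVec]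
      exact dressMatrix_conj_mulVec (dressVec_dressedPhi_ne_zero b x hlam hinj)
        (ne_conj_of_im_pos (hlam _) (hlam _))
    · rw [@ih (fun k => lam k.castSucc) (fun k => b k.castSucc) (fun k => hlam _)
        (hinj.comp (Fin.castSucc_injective n)) k, Matrix.mulVec_zero]

theorem differentiableOn_dressedPhi {n : ℕ} (lam b : Fin n → ℂ) (x : ℝ) (i j : Fin 2) :
    DifferentiableOn ℂ (fun z => dressedPhi n lam b x z i j) (Set.range lam)ᶜ := by
  induction n generalizing i j with
  | zero => exact (differentiable_seed x i j).differentiableOn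
  | succ n ih =>
    simp only [dressedPhi, Matrix.mul_apply, Fin.sum_univ_two]
    have h1 : (Set.range lam)ᶜ ⊆ {lam (Fin.last n)}ᶜ := by
      rw [Set.compl_subset_compl]; simp
    have h2 : (Set.range lam)ᶜ ⊆ (Set.range fun k : Fin n => lam k.castSucc)ᶜ := by
      rw [Set.compl_subset_compl]
      rintro _ ⟨k, rfl⟩
      exact ⟨_, rfl⟩
    exact (((differentiableOn_dressMatrix _ _ i 0).mono h1).mul ((ih _ _ 0 j).mono h2)).add
      (((differentiableOn_dressMatrix _ _ i 1).mono h1).mul ((ih _ _ 1 j).mono h2))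

/-- The dressed solution with the exponentials of the seed removed: the product of the dressing
matrices. -/
noncomputable def dressProd {n : ℕ} (lam b : Fin n → ℂ) (x : ℝ) (z : ℂ) : Mat2 :=
  dressedPhi n lam b x z * seed x (-z)

/-- The `1/z` coefficients of the factors add up. Each is `(μ - conj μ) P`, anti-Hermitian because
the scalar is imaginary, and `2i` times its upper right entry is the increment of the potential. -/
theorem tendsto_cobounded_dressProd {n : ℕ} (lam b : Fin n → ℂ) (x : ℝ) :
    ∃ K : Mat2, Tendsto (fun z => z • (dressProd lam b x z - 1)) (Bornology.cobounded ℂ) (𝓝 K) ∧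
      Kᴴ = -K ∧ 2 * Complex.I * K 0 1 = dressedPotential n lam b x := by
  induction n with
  | zero =>
    refine ⟨0, ?_, by simp, by simp [dressedPotential]⟩
    simp [dressProd, dressedPhi, seed_mul_seed_neg]
  | succ n ih =>
    obtain ⟨K, hK, hK', hψ⟩ := ih (fun k => lam k.castSucc) (fun k => b k.castSucc)
    set μ := lam (Fin.last n) with hμ
    set q := dressVec (dressedPhi n (fun k => lam k.castSucc) (fun k => b k.castSucc) x) μ
      (b (Fin.last n)) with hq
    refine ⟨(μ - conj μ) • dressProj q + K, ?_, ?_, ?_⟩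
    -- Uses `z (χ F - 1) = z (χ - 1) F + z (F - 1)`.
    · have h := ((tendsto_cobounded_dressMatrix μ q).mul
        (tendsto_one_of_tendsto_smul_sub hK)).add hK
      rw [mul_one] at h
      refine h.congr fun z => ?_
      have : dressProd lam b x z = dressMatrix μ q z *
          dressProd (fun k : Fin n => lam k.castSucc) (fun k => b k.castSucc) x z := by
        simp only [dressProd, dressedPhi, Matrix.mul_assoc, ← hμ, ← hq]
      rw [this, smul_mul_assoc, ← smul_add]
      congr 1
      noncomm_ring
    · rw [Matrix.conjTranspose_add, Matrix.conjTranspose_smul, dressProj_conjTranspose, hK',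
        neg_add, ← neg_smul]
      simp
    · simp only [dressedPotential, ← hμ, ← hq, ← hψ]
      simp [dressProj]
      ring

/-! ### Uniqueness for the Riemann-Hilbert problem -/

/-- If `(z - w) f` and `g` are analytic near `w` with the same value at `w`, then
`f - g / (z - w)` has a removable singularity at `w`. -/
theorem exists_tendsto_sub_div {f g : ℂ → ℂ} {w r : ℂ}
    (hf : ∀ᶠ z in 𝓝[≠] w, DifferentiableAt ℂ f z) (hg : ∀ᶠ z in 𝓝[≠] w, DifferentiableAt ℂ g z)
    (hfr : Tendsto (fun z => (z - w) * f z) (𝓝[≠] w) (𝓝 r)) (hgr : Tendsto g (𝓝[≠] w) (𝓝 r)) :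
    ∃ l, Tendsto (fun z => f z - g z / (z - w)) (𝓝[≠] w) (𝓝 l) := by
  have hne : ∀ᶠ z in 𝓝[≠] w, z ≠ w := eventually_mem_nhdsWithin
  -- With value `0` at `w`, `h` is analytic there, and its slope at `w` is `f - g / (z - w)`.
  set h : ℂ → ℂ := Function.update (fun z => (z - w) * f z - g z) w 0 with hh
  have heq : h =ᶠ[𝓝[≠] w] fun z => (z - w) * f z - g z := by
    filter_upwards [hne] with z hz
    simp [hh, hz]
  have hcont : ContinuousAt h w := by
    rw [hh, continuousAt_update_same]
    simpa using hfr.sub hgr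
  have hdiff : ∀ᶠ z in 𝓝[≠] w, DifferentiableAt ℂ h z := by
    have heq' := eventually_eventually_nhdsWithin.2 heq
    filter_upwards [hf, hg, heq', hne] with z hfz hgz hz hzw
    have : h =ᶠ[𝓝 z] fun z => (z - w) * f z - g z := by
      rwa [isOpen_compl_singleton.nhdsWithin_eq hzw] at hz
    refine DifferentiableAt.congr_of_eventuallyEq ?_ this
    fun_prop
  have hd := (Complex.analyticAt_of_differentiable_on_punctured_nhds_of_continuousAt hdiff
    hcont).differentiableAt.hasDerivAt.tendsto_slope
  refine ⟨_, hd.congr' ?_⟩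
  filter_upwards [heq, hne] with z hz hzw
  have hzw' := sub_ne_zero.2 hzw
  have hw : h w = 0 := by simp [hh]
  rw [slope_def_field, hz, hw]
  field_simp
  ring

theorem eventually_notMem_of_finite {S : Set ℂ} (hS : S.Finite) (w : ℂ) :
    ∀ᶠ z in 𝓝[≠] w, z ∉ S := by
  have : (S \ {w})ᶜ ∈ 𝓝 w :=
    (hS.subset Set.sdiff_subset).isClosed.isOpen_compl.mem_nhds (by simp)
  filter_upwards [mem_nhdsWithin_of_mem_nhds this, self_mem_nhdsWithin] with z h1 h2 h3
  exact h1 ⟨h3, h2⟩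

/-- A function that is analytic off a finite set, where it has only removable singularities, and has
a limit at infinity is constant. -/
theorem eqOn_const_of_tendsto_cobounded {f : ℂ → ℂ} {S : Set ℂ} (hS : S.Finite) {c : ℂ}
    (hf : DifferentiableOn ℂ f Sᶜ) (hlim : ∀ w ∈ S, ∃ l, Tendsto f (𝓝[≠] w) (𝓝 l))
    (hc : Tendsto f (Bornology.cobounded ℂ) (𝓝 c)) {z : ℂ} (hz : z ∉ S) : f z = c := by
  -- Taking punctured limits fills in the removable singularities and changes nothing off `S`.
  set F : ℂ → ℂ := fun z => limUnder (𝓝[≠] z) f with hF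
  have hd : ∀ z ∉ S, DifferentiableAt ℂ f z := fun z hz =>
    hf.differentiableAt (hS.isClosed.isOpen_compl.mem_nhds hz)
  have hFf : ∀ z ∉ S, F z = f z := fun z hz =>
    ((hd z hz).continuousAt.tendsto.mono_left nhdsWithin_le_nhds).limUnder_eq
  have hdF : Differentiable ℂ F := by
    intro w
    by_cases hw : w ∈ S
    · have hpunct := eventually_notMem_of_finite hS w
      have heq : ∀ᶠ z in 𝓝[≠] w, F z = f z := hpunct.mono hFf
      refine (Complex.analyticAt_of_differentiable_on_punctured_nhds_of_continuousAt ?_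
        ?_).differentiableAt
      · filter_upwards [hpunct] with z hz
        refine (hd z hz).congr_of_eventuallyEq ?_
        filter_upwards [hS.isClosed.isOpen_compl.mem_nhds hz] with y hy using hFf y hy
      · rw [continuousAt_iff_punctured_nhds]
        obtain ⟨l, hl⟩ := hlim w hw
        have : F w = l := hl.limUnder_eq
        rw [this]
        exact hl.congr' (heq.mono fun _ h => h.symm)
    · refine (hd w hw).congr_of_eventuallyEq ?_
      filter_upwards [hS.isClosed.isOpen_compl.mem_nhds hw] with y hy using hFf y hy
  have hcF : Tendsto F (cocompact ℂ) (𝓝 c) := by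
    rw [← Metric.cobounded_eq_cocompact]
    refine hc.congr' ?_
    filter_upwards [Bornology.isBounded_def.1 hS.isBounded] with y hy using (hFf y hy).symm
  rw [← hFf z hz]
  exact hdF.apply_eq_of_tendsto_cocompact z hcF

theorem poleSet_finite {N : ℕ} (lam : Fin N → ℂ) : (poleSet lam).Finite := by
  have : poleSet lam = Set.range lam ∪ Set.range fun n => conj (lam n) := by
    ext z
    simp only [poleSet, Set.mem_ofPred_eq, Set.mem_union, Set.mem_range, eq_comm (a := z),
      exists_or]
  rw [this]
  exact (Set.finite_range _).union (Set.finite_range _)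

/-- The factor `1 - A / (z - w)` removes the singularity of a matrix function satisfying the residue
condition with matrix `A`. -/
theorem ResidueCondition.exists_tendsto {M : ℂ → Mat2} {w : ℂ} {A : Mat2}
    (h : ResidueCondition M w A)
    (hM : ∀ i j, ∀ᶠ z in 𝓝[≠] w, DifferentiableAt ℂ (fun z => M z i j) z) :
    ∃ G : Mat2, Tendsto (fun z => M z * (1 - (z - w)⁻¹ • A)) (𝓝[≠] w) (𝓝 G) := by
  obtain ⟨R, h1, h2⟩ := h
  have key : ∀ i j, ∃ l, Tendsto (fun z => M z i j - (M z * A) i j / (z - w)) (𝓝[≠] w) (𝓝 l) := by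
    intro i j
    refine exists_tendsto_sub_div (hM i j) ?_
      ((tendsto_pi_nhds.1 ((tendsto_pi_nhds.1 h1) i)) j)
      ((tendsto_pi_nhds.1 ((tendsto_pi_nhds.1 h2) i)) j)
    filter_upwards [hM i 0, hM i 1] with z hz0 hz1
    simp only [Matrix.mul_apply, Fin.sum_univ_two]
    fun_prop
  choose G hG using key
  refine ⟨G, tendsto_pi_nhds.2 fun i => tendsto_pi_nhds.2 fun j => (hG i j).congr fun z => ?_⟩
  simp [mul_sub, div_eq_inv_mul]

/-- `T = 1 - A / (z - w)` has determinant `1` because `A` is nilpotent. Hence `M' adj M = (M' T) adj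
(M T)`, and both factors on the right have limits. -/
theorem ResidueCondition.exists_tendsto_mul_adjugate {M M' : ℂ → Mat2} {w : ℂ} {A : Mat2}
    (hA : A.det = 0) (hA' : A.trace = 0) (h : ResidueCondition M w A)
    (h' : ResidueCondition M' w A)
    (hM : ∀ i j, ∀ᶠ z in 𝓝[≠] w, DifferentiableAt ℂ (fun z => M z i j) z)
    (hM' : ∀ i j, ∀ᶠ z in 𝓝[≠] w, DifferentiableAt ℂ (fun z => M' z i j) z) :
    ∃ G : Mat2, Tendsto (fun z => M' z * (M z).adjugate) (𝓝[≠] w) (𝓝 G) := by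
  obtain ⟨G, hG⟩ := h.exists_tendsto hM
  obtain ⟨G', hG'⟩ := h'.exists_tendsto hM'
  have hadj : Continuous fun X : Mat2 => X.adjugate := continuous_id.matrix_adjugate
  refine ⟨G' * G.adjugate, (hG'.mul ((hadj.tendsto G).comp hG)).congr fun z => ?_⟩
  have hdet : (1 - (z - w)⁻¹ • A).det = 1 := by
    rw [Matrix.det_fin_two] at hA
    rw [Matrix.trace_fin_two] at hA'
    simp [Matrix.det_fin_two]
    linear_combination (z - w)⁻¹ ^ 2 * hA - (z - w)⁻¹ * hA'
  simp only [Function.comp]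
  rw [Matrix.adjugate_mul_distrib, Matrix.mul_assoc, ← Matrix.mul_assoc (1 - _),
    Matrix.mul_adjugate, hdet, one_smul, Matrix.one_mul]

theorem tendsto_one_of_isBigO_inv {M : ℂ → Mat2}
    (h : ∀ i j, (fun z => M z i j - (1 : Mat2) i j) =O[Bornology.cobounded ℂ] fun z => z⁻¹) :
    Tendsto M (Bornology.cobounded ℂ) (𝓝 1) := by
  refine tendsto_pi_nhds.2 fun i => tendsto_pi_nhds.2 fun j => ?_
  have := ((h i j).trans_tendsto tendsto_inv₀_cobounded).add_const ((1 : Mat2) i j)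
  simpa using this

theorem IsRHPSolution.mul_adjugate_eq_one {N : ℕ} {lam c : Fin N → ℂ} {x t : ℝ} {M M' : ℂ → Mat2}
    (h : IsRHPSolution lam c x t M) (h' : IsRHPSolution lam c x t M') {z : ℂ}
    (hz : z ∉ poleSet lam) : M' z * (M z).adjugate = 1 := by
  have hS := poleSet_finite lam
  have hdiff : ∀ {M : ℂ → Mat2}, IsRHPSolution lam c x t M → ∀ w i j,
      ∀ᶠ z in 𝓝[≠] w, DifferentiableAt ℂ (fun z => M z i j) z := fun hM w i j =>
    (eventually_notMem_of_finite hS w).mono fun z hz =>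
      (hM.analytic i j).differentiableAt (hS.isClosed.isOpen_compl.mem_nhds hz)
  have hlim : ∀ w ∈ poleSet lam,
      ∃ G : Mat2, Tendsto (fun z => M' z * (M z).adjugate) (𝓝[≠] w) (𝓝 G) := by
    rintro w ⟨n, rfl | rfl⟩
    · exact (h.residue_upper n).exists_tendsto_mul_adjugate (by simp [Matrix.det_fin_two])
        (by simp [Matrix.trace_fin_two]) (h'.residue_upper n) (hdiff h _) (hdiff h' _)
    · exact (h.residue_lower n).exists_tendsto_mul_adjugate (by simp [Matrix.det_fin_two])
        (by simp [Matrix.trace_fin_two]) (h'.residue_lower n) (hdiff h _) (hdiff h' _)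
  have hinf : Tendsto (fun z => M' z * (M z).adjugate) (Bornology.cobounded ℂ) (𝓝 1) := by
    have hadj : Continuous fun X : Mat2 => X.adjugate := continuous_id.matrix_adjugate
    simpa using (tendsto_one_of_isBigO_inv h'.normalization).mul
      ((hadj.tendsto 1).comp (tendsto_one_of_isBigO_inv h.normalization))
  ext i j
  refine eqOn_const_of_tendsto_cobounded (f := fun z => (M' z * (M z).adjugate) i j) hS ?_ ?_
    ((tendsto_pi_nhds.1 ((tendsto_pi_nhds.1 hinf) i)) j) hz
  · have h00 := h.analytic 0 0
    have h01 := h.analytic 0 1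
    have h10 := h.analytic 1 0
    have h11 := h.analytic 1 1
    have h0 := h'.analytic i 0
    have h1 := h'.analytic i 1
    simp only [Matrix.mul_apply, Fin.sum_univ_two, Matrix.adjugate_fin_two]
    fin_cases j <;> simp <;> fun_prop
  · intro w hw
    obtain ⟨G, hG⟩ := hlim w hw
    exact ⟨G i j, (tendsto_pi_nhds.1 ((tendsto_pi_nhds.1 hG) i)) j⟩

/-- The solution of the Riemann-Hilbert problem is unique. -/
theorem IsRHPSolution.eqOn {N : ℕ} {lam c : Fin N → ℂ} {x t : ℝ} {M M' : ℂ → Mat2}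
    (h : IsRHPSolution lam c x t M) (h' : IsRHPSolution lam c x t M') :
    Set.EqOn M' M (poleSet lam)ᶜ := by
  intro z hz
  -- Comparing `M` with itself gives `det M = 1`, so `adj M` is its inverse.
  have h1 := h.mul_adjugate_eq_one h hz
  have h2 := h.mul_adjugate_eq_one h' hz
  have h3 : (M z).adjugate * M z = 1 := by
    rw [Matrix.adjugate_mul, ← Matrix.mul_adjugate, h1]
  calc M' z = M' z * ((M z).adjugate * M z) := by rw [h3, Matrix.mul_one]
    _ = M z := by rw [← Matrix.mul_assoc, h2, Matrix.one_mul]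

/-! ### The solution of the Riemann-Hilbert problem -/

section DressProd

variable {N : ℕ} {lam b : Fin N → ℂ} {x : ℝ}

theorem det_dressProd (hlam : ∀ k, 0 < (lam k).im) (hinj : Function.Injective lam) {z : ℂ}
    (hz : ∀ k, z ≠ lam k) :
    (dressProd lam b x z).det = ∏ k, (z - conj (lam k)) / (z - lam k) := by
  rw [dressProd, Matrix.det_mul, det_seed, mul_one, det_dressedPhi b x hlam hinj hz]

theorem dressProd_mul_conjTranspose (hlam : ∀ k, 0 < (lam k).im) (hinj : Function.Injective lam)
    {z : ℂ} (hz : z ∉ poleSet lam) :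
    dressProd lam b x z * (dressProd lam b x (conj z))ᴴ = 1 := by
  have h : (seed x (-conj z))ᴴ = seed x z := by
    rw [← map_neg, conjTranspose_seed_conj, neg_neg]
  rw [dressProd, dressProd, Matrix.conjTranspose_mul, h, Matrix.mul_assoc,
    ← Matrix.mul_assoc (seed x (-z)), seed_neg_mul_seed, Matrix.one_mul]
  exact dressedPhi_mul_conjTranspose b x hlam hinj (fun k hk => hz ⟨k, Or.inl hk⟩)
    fun k hk => hz ⟨k, Or.inr hk⟩

theorem differentiableOn_dressProd (i j : Fin 2) :
    DifferentiableOn ℂ (fun z => dressProd lam b x z i j) (Set.range lam)ᶜ := by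
  simp only [dressProd, Matrix.mul_apply, Fin.sum_univ_two]
  have h : ∀ i j, DifferentiableOn ℂ (fun z => seed x (-z) i j) (Set.range lam)ᶜ := fun i j =>
    ((differentiable_seed x i j).comp differentiable_neg).differentiableOn
  exact ((differentiableOn_dressedPhi lam b x i 0).mul (h 0 j)).add
    ((differentiableOn_dressedPhi lam b x i 1).mul (h 1 j))

theorem differentiableAt_dressProd (i j : Fin 2) {z : ℂ} (hz : ∀ k, z ≠ lam k) :
    DifferentiableAt ℂ (fun z => dressProd lam b x z i j) z := by
  refine (differentiableOn_dressProd i j).differentiableAt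
    ((Set.finite_range lam).isClosed.isOpen_compl.mem_nhds ?_)
  rintro ⟨k, rfl⟩
  exact hz k rfl

/-- At `conj (lam k)` the columns of the product of the dressing matrices are proportional. -/
theorem dressProd_conj_apply_one (hlam : ∀ k, 0 < (lam k).im) (hinj : Function.Injective lam)
    (k : Fin N) (i : Fin 2) :
    conj (b k) * dressProd lam b x (conj (lam k)) i 1 =
      -Complex.exp (-2 * Complex.I * conj (lam k) * x) * dressProd lam b x (conj (lam k)) i 0 := by
  have h := congrFun (dressedPhi_conj_mulVec b x hlam hinj k) i
  simp only [Matrix.mulVec, dotProduct, Fin.sum_univ_two, Pi.zero_apply] at h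
  simp only [dressProd, seed, Matrix.mul_apply, Fin.sum_univ_two]
  simp at h ⊢
  have e : Complex.exp (-(2 * Complex.I * conj (lam k) * x)) *
      Complex.exp (Complex.I * conj (lam k) * x) = Complex.exp (-(Complex.I * conj (lam k) * x)) := by
    rw [← Complex.exp_add]
    ring_nf
  linear_combination Complex.exp (-(Complex.I * conj (lam k) * x)) * h +
    dressedPhi N lam b x (conj (lam k)) i 0 * e

end DressProd

/-- The Blaschke product with zeros `lam k` and poles `conj (lam k)`. -/
noncomputable def blaschke {N : ℕ} (lam : Fin N → ℂ) (z : ℂ) : ℂ :=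
  ∏ k, (z - lam k) / (z - conj (lam k))

/-- The matrix with first column `(a, c)` that of the product of the dressing matrices, and second
column `(-c*, a*)`, where `f* z = conj (f (conj z))`. -/
noncomputable def rhpMatrix {N : ℕ} (lam b : Fin N → ℂ) (x : ℝ) (z : ℂ) : Mat2 :=
  !![dressProd lam b x z 0 0, -conj (dressProd lam b x (conj z) 1 0);
     dressProd lam b x z 1 0, conj (dressProd lam b x (conj z) 0 0)]

/-! ### Residues, symmetry and asymptotics of the Riemann-Hilbert matrix. -/

section RhpMatrix

variable {N : ℕ} {lam b : Fin N → ℂ} {x : ℝ}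

/-- The Blaschke product is `1 / det D`, so the rescaled adjugate of `D(z)` is its inverse `D(conj
z)ᴴ`. Comparing first rows identifies the second column. -/
theorem rhpMatrix_eq (hlam : ∀ k, 0 < (lam k).im) (hinj : Function.Injective lam) {z : ℂ}
    (hz : z ∉ poleSet lam) :
    rhpMatrix lam b x z = dressProd lam b x z * !![1, 0; 0, blaschke lam z] := by
  have h1 : ∀ k, z - lam k ≠ 0 := fun k => sub_ne_zero.2 fun hk => hz ⟨k, Or.inl hk⟩
  have h2 : ∀ k, z - conj (lam k) ≠ 0 := fun k => sub_ne_zero.2 fun hk => hz ⟨k, Or.inr hk⟩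
  have hB : blaschke lam z * (dressProd lam b x z).det = 1 := by
    rw [det_dressProd hlam hinj fun k => sub_ne_zero.1 (h1 k), blaschke, ← Finset.prod_mul_distrib]
    refine Finset.prod_eq_one fun k _ => ?_
    have := h1 k
    have := h2 k
    field_simp
  have hadj : blaschke lam z • (dressProd lam b x z).adjugate =
      (dressProd lam b x (conj z))ᴴ := by
    have hD := dressProd_mul_conjTranspose (b := b) (x := x) hlam hinj hz
    calc _ = blaschke lam z • (dressProd lam b x z).adjugate *
          (dressProd lam b x z * (dressProd lam b x (conj z))ᴴ) := by rw [hD, Matrix.mul_one]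
      _ = (blaschke lam z * (dressProd lam b x z).det) • (dressProd lam b x (conj z))ᴴ := by
        rw [← Matrix.mul_assoc, Matrix.smul_mul, Matrix.adjugate_mul, smul_smul, Matrix.smul_mul,
          Matrix.one_mul]
      _ = _ := by rw [hB, one_smul]
  have h00 := congrFun (congrFun hadj 0) 0
  have h01 := congrFun (congrFun hadj 0) 1
  simp [Matrix.adjugate_fin_two] at h00 h01
  ext i j
  fin_cases i <;> fin_cases j <;> simp [rhpMatrix, Matrix.mul_apply, ← h00, ← h01, mul_comm]

theorem differentiableOn_rhpMatrix (i j : Fin 2) :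
    DifferentiableOn ℂ (fun z => rhpMatrix lam b x z i j) (poleSet lam)ᶜ := by
  intro z hz
  have h1 : ∀ k, z ≠ lam k := fun k hk => hz ⟨k, Or.inl hk⟩
  have h2 : ∀ k, conj z ≠ lam k := fun k hk => hz ⟨k, Or.inr (by rw [← hk, Complex.conj_conj])⟩
  have h3 : ∀ i, DifferentiableAt ℂ (fun z => conj (dressProd lam b x (conj z) i 0)) z := fun i =>
    differentiableAt_conj_conj_iff.2 (differentiableAt_dressProd i 0 h2)
  apply DifferentiableAt.differentiableWithinAt
  fin_cases i <;> fin_cases j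
  · exact differentiableAt_dressProd 0 0 h1
  · exact (h3 1).neg
  · exact differentiableAt_dressProd 1 0 h1
  · exact h3 0

/-- The reality condition satisfied by the solution of the Riemann-Hilbert problem. -/
theorem rhpMatrix_symm (z : ℂ) : rhpMatrix lam b x z =
    (rhpMatrix lam b x (conj z)).adjugateᴴ := by
  ext i j
  fin_cases i <;> fin_cases j <;> simp [rhpMatrix, Matrix.adjugate_fin_two]

theorem tendsto_conj_nhdsNE (w : ℂ) :
    Tendsto (fun z : ℂ => conj z) (𝓝[≠] w) (𝓝[≠] (conj w)) :=
  tendsto_nhdsWithin_of_tendsto_nhds_of_eventually_within _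
    (Complex.continuous_conj.continuousAt.tendsto.mono_left nhdsWithin_le_nhds)
    (eventually_mem_nhdsWithin.mono fun _ hz h => hz ((starRingEnd ℂ).injective h))

/-- The map `X ↦ (adj X)ᴴ` on `2 × 2` matrices is continuous, conjugate-linear and multiplicative,
so it carries the condition at `conj w` to the one at `w`. -/
theorem residueCondition_of_symm {M : ℂ → Mat2} {w s : ℂ}
    (hM : ∀ z, M z = (M (conj z)).adjugateᴴ)
    (h : ResidueCondition M (conj w) !![0, -conj s; 0, 0]) :
    ResidueCondition M w !![0, 0; s, 0] := by
  obtain ⟨R, h1, h2⟩ := h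
  have hc : Continuous fun X : Mat2 => X.adjugateᴴ :=
    continuous_id.matrix_adjugate.matrix_conjTranspose
  refine ⟨_, ((hc.tendsto R).comp (h1.comp (tendsto_conj_nhdsNE w))).congr fun z => ?_,
    ((hc.tendsto R).comp (h2.comp (tendsto_conj_nhdsNE w))).congr fun z => ?_⟩
  · rw [hM z]
    ext i j
    fin_cases i <;> fin_cases j <;> simp [Matrix.adjugate_fin_two]
  · rw [hM z]
    ext i j
    fin_cases i <;> fin_cases j <;>
      simp [Matrix.adjugate_fin_two, Matrix.mul_apply, Fin.sum_univ_two]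

theorem tendsto_sub_mul_blaschke (hinj : Function.Injective lam) (n : Fin N) :
    Tendsto (fun z => (z - conj (lam n)) * blaschke lam z) (𝓝[≠] (conj (lam n)))
      (𝓝 ((∏ l, (conj (lam n) - lam l)) *
        ∏ l ∈ Finset.univ.erase n, 1 / (conj (lam n) - conj (lam l)))) := by
  have hc : ContinuousAt (fun z => (∏ l, (z - lam l)) *
      ∏ l ∈ Finset.univ.erase n, 1 / (z - conj (lam l))) (conj (lam n)) := by
    refine ContinuousAt.mul (by fun_prop) (tendsto_finsetProd _ fun l hl => ?_)
    have hne : conj (lam n) - conj (lam l) ≠ 0 := sub_ne_zero.2 fun h =>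
      (Finset.ne_of_mem_erase hl) (hinj ((starRingEnd ℂ).injective h)).symm
    have : ContinuousAt (fun z => 1 / (z - conj (lam l))) (conj (lam n)) := by
      fun_prop (disch := assumption)
    exact this
  refine (hc.tendsto.mono_left nhdsWithin_le_nhds).congr' ?_
  filter_upwards [eventually_mem_nhdsWithin] with z hz
  have hz' : z - conj (lam n) ≠ 0 := sub_ne_zero.2 hz
  have : blaschke lam z = (∏ l, (z - lam l)) * ∏ l, 1 / (z - conj (lam l)) := by
    rw [blaschke, ← Finset.prod_mul_distrib]
    simp only [mul_one_div]
  rw [this, ← Finset.mul_prod_erase _ (fun l => 1 / (z - conj (lam l))) (Finset.mem_univ n)]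
  field_simp

theorem residueCondition_rhpMatrix_conj (hlam : ∀ k, 0 < (lam k).im)
    (hinj : Function.Injective lam) (hb : ∀ k, b k ≠ 0) (n : Fin N) :
    ResidueCondition (rhpMatrix lam b x) (conj (lam n))
      !![0, -conj (1 / b n * (∏ l, (lam n - conj (lam l))) *
        ∏ l ∈ Finset.univ.erase n, 1 / (lam n - lam l)) *
          Complex.exp (-2 * Complex.I * conj (lam n) * x); 0, 0] := by
  set w := conj (lam n) with hw
  -- The residue of the Blaschke product at `w`.
  set β := (∏ l, (w - lam l)) * ∏ l ∈ Finset.univ.erase n, 1 / (w - conj (lam l)) with hβ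
  have hα : -conj (1 / b n * (∏ l, (lam n - conj (lam l))) *
        ∏ l ∈ Finset.univ.erase n, 1 / (lam n - lam l)) *
          Complex.exp (-2 * Complex.I * w * x) =
      -(β / conj (b n)) * Complex.exp (-2 * Complex.I * w * x) := by
    simp [hβ, hw, map_prod]
    ring
  rw [hα]
  set e := Complex.exp (-2 * Complex.I * w * x) with he
  have hwne : ∀ k, w ≠ lam k := fun k => (ne_conj_of_im_pos (hlam k) (hlam n)).symm
  have hD : Tendsto (dressProd lam b x) (𝓝[≠] w) (𝓝 (dressProd lam b x w)) :=
    tendsto_pi_nhds.2 fun i => tendsto_pi_nhds.2 fun j =>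
      (differentiableAt_dressProd i j hwne).continuousAt.tendsto.mono_left nhdsWithin_le_nhds
  have hoff := eventually_notMem_of_finite (poleSet_finite lam) w
  have hdiag : Tendsto (fun z => (!![z - w, 0; 0, (z - w) * blaschke lam z] : Mat2)) (𝓝[≠] w)
      (𝓝 !![0, 0; 0, β]) := by
    have h0 : Tendsto (fun z => z - w) (𝓝[≠] w) (𝓝 0) := by
      have : Continuous fun z => z - w := by fun_prop
      simpa using (this.tendsto w).mono_left nhdsWithin_le_nhds
    refine tendsto_pi_nhds.2 fun i => tendsto_pi_nhds.2 fun j => ?_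
    fin_cases i <;> fin_cases j
    · simpa using h0
    · simp
    · simp
    · exact tendsto_sub_mul_blaschke hinj n
  refine ⟨dressProd lam b x w * !![0, 0; 0, β], (hD.mul hdiag).congr' ?_, ?_⟩
  · filter_upwards [hoff] with z hz
    rw [rhpMatrix_eq hlam hinj hz, ← Matrix.mul_smul]
    congr 1
    ext i j
    fin_cases i <;> fin_cases j <;> simp
  -- The kernel relation at `w` trades the second column of `D` for the first.
  · have hR : dressProd lam b x w * !![0, 0; 0, β] =
        dressProd lam b x w * !![0, -(β / conj (b n)) * e; 0, 0] := by
      have hbn : conj (b n) ≠ 0 := by simpa using hb n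
      have key := fun i => dressProd_conj_apply_one (b := b) (x := x) hlam hinj n i
      rw [← hw, ← he] at key
      ext i j
      fin_cases j
      · simp [Matrix.mul_apply, Fin.sum_univ_two]
      · simp only [Matrix.mul_apply, Fin.sum_univ_two]
        simp
        field_simp
        linear_combination β * key i
    -- The residue matrix only sees the first column, which the Blaschke factor leaves unchanged.
    rw [hR]
    refine (hD.mul_const _).congr' ?_
    filter_upwards [hoff] with z hz
    rw [rhpMatrix_eq hlam hinj hz, Matrix.mul_assoc]
    congr 1
    ext i j
    fin_cases i <;> fin_cases j <;> simp [Matrix.mul_apply, Fin.sum_univ_two]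

theorem tendsto_conj_cobounded :
    Tendsto (fun z : ℂ => conj z) (Bornology.cobounded ℂ) (Bornology.cobounded ℂ) := by
  rw [← tendsto_norm_atTop_iff_cobounded]
  simpa using tendsto_norm_cobounded_atTop (E := ℂ)

/-- The asymptotics of the solution of the Riemann-Hilbert problem at infinity. -/
theorem tendsto_cobounded_rhpMatrix (lam b : Fin N → ℂ) (x : ℝ) :
    ∃ K : Mat2, Tendsto (fun z => z • (rhpMatrix lam b x z - 1)) (Bornology.cobounded ℂ) (𝓝 K) ∧
      2 * Complex.I * K 0 1 = dressedPotential N lam b x := by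
  obtain ⟨K, hK, hK', hψ⟩ := tendsto_cobounded_dressProd lam b x
  have h : ∀ i j, Tendsto (fun z => (z • (dressProd lam b x z - 1)) i j) (Bornology.cobounded ℂ)
      (𝓝 (K i j)) := fun i j => (tendsto_pi_nhds.1 ((tendsto_pi_nhds.1 hK) i)) j
  have hconj : ∀ i j, Tendsto (fun z => conj ((conj z • (dressProd lam b x (conj z) - 1)) i j))
      (Bornology.cobounded ℂ) (𝓝 (conj (K i j))) := fun i j =>
    (Complex.continuous_conj.tendsto _).comp ((h i j).comp tendsto_conj_cobounded)
  refine ⟨!![K 0 0, -conj (K 1 0); K 1 0, conj (K 0 0)], ?_, ?_⟩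
  · refine tendsto_pi_nhds.2 fun i => tendsto_pi_nhds.2 fun j => ?_
    fin_cases i <;> fin_cases j
    · exact h 0 0
    · refine (hconj 1 0).neg.congr fun z => ?_
      simp [rhpMatrix]
    · exact h 1 0
    · refine (hconj 0 0).congr fun z => ?_
      simp [rhpMatrix]
  -- Anti-Hermitian `K` gives `-conj (K 1 0) = K 0 1`.
  · have := congrFun (congrFun hK' 0) 1
    simp at this
    simp [this, ← hψ]

theorem isBigO_inv_of_tendsto_smul_sub {F : ℂ → Mat2} {K : Mat2}
    (h : Tendsto (fun z => z • (F z - 1)) (Bornology.cobounded ℂ) (𝓝 K)) (i j : Fin 2) :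
    (fun z => F z i j - (1 : Mat2) i j) =O[Bornology.cobounded ℂ] fun z => z⁻¹ := by
  have h1 : (fun z => z * (F z i j - (1 : Mat2) i j)) =O[Bornology.cobounded ℂ]
      fun _ => (1 : ℂ) :=
    ((tendsto_pi_nhds.1 ((tendsto_pi_nhds.1 h) i)) j).isBigO_one ℂ
  refine ((Asymptotics.isBigO_refl (fun z : ℂ => z⁻¹) _).mul h1).congr' ?_ (by simp)
  filter_upwards [Bornology.eventually_ne_cobounded (0 : ℂ)] with z hz
  field_simp

end RhpMatrix

end SolitonNLS

theorem theorem3p1 (N : ℕ) (lam p c : Fin N → ℂ)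
    (hlam : ∀ n, 0 < (lam n).im) (hinj : Function.Injective lam) (hp : ∀ n, p n ≠ 0)
    (hc : ∀ n, c n = 1 / p n * (∏ l, (lam n - conj (lam l))) *
      ∏ l ∈ Finset.univ.erase n, 1 / (lam n - lam l)) :
    SolitonNLS.IsISTSolution lam c (SolitonNLS.darbouxSolution lam p) := by
  open SolitonNLS in
  intro x t
  set b : Fin N → ℂ := fun n => p n * Complex.exp (-2 * Complex.I * t * lam n ^ 2) with hb
  have hb0 : ∀ n, b n ≠ 0 := fun n => mul_ne_zero (hp n) (Complex.exp_ne_zero _)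
  obtain ⟨K, hK, hψ⟩ := tendsto_cobounded_rhpMatrix lam b x
  have hphase : ∀ n, conj (phase (lam n) x t) = phase (conj (lam n)) x t := fun n => by
    simp [phase]
  have hlower : ∀ n, ResidueCondition (rhpMatrix lam b x) (conj (lam n))
      !![0, -conj (c n) * Complex.exp (-2 * Complex.I * phase (conj (lam n)) x t); 0, 0] := by
    intro n
    convert residueCondition_rhpMatrix_conj (x := x) hlam hinj hb0 n using 5
    rw [hc n]
    -- The time part of the phase is absorbed by the evolved parameter `b n`, which enters the
    -- norming constant inverted.
    have he : Complex.exp (-2 * Complex.I * phase (conj (lam n)) x t) =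
        (conj (Complex.exp (-2 * Complex.I * t * lam n ^ 2)))⁻¹ *
          Complex.exp (-2 * Complex.I * conj (lam n) * x) := by
      rw [← Complex.exp_conj, ← Complex.exp_neg, ← Complex.exp_add]
      congr 1
      simp [phase, Complex.conj_ofNat]
      ring
    rw [he]
    simp only [hb, map_mul, one_div, mul_inv, map_inv₀]
    ring
  have hsol : IsRHPSolution lam c x t (rhpMatrix lam b x) := by
    refine ⟨differentiableOn_rhpMatrix, fun n => residueCondition_of_symm rhpMatrix_symm ?_, hlower,
      isBigO_inv_of_tendsto_smul_sub hK⟩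
    convert hlower n using 5
    rw [map_mul, ← Complex.exp_conj, neg_mul]
    simp [hphase, Complex.conj_ofNat]
  refine ⟨_, hsol, fun M' h' => hsol.eqOn h', ?_⟩
  have h01 := ((tendsto_pi_nhds.1 ((tendsto_pi_nhds.1 hK) 0)) 1).const_mul (2 * Complex.I)
  rw [hψ] at h01
  refine h01.congr fun z => ?_
  simp [mul_assoc]
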